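/- Let $R$ be a commutative ring. For an $R$-$R$-bimodule $B$ (the two $R$-module structures commute, but need not agree) and $r\in R$, put $F^{(r)}_{-1}B=0$ and $F^{(r)}_nB=\{\,b\in B\mid rb-br\in F^{(r)}_{n-1}B\,\}$ for integers $n\ge 0$. The bimodule $B$ is called a \emph{quasi-module} over $R$ if $B=\bigcup_{n\ge0}F^{(r)}_nB$ for every $r\in R$; equivalently, if for all $r\in R$ and $b\in B$ some iterate $\theta_r^{\,n+1}$, $n\ge0$, of the operator $\theta_r(x)=rx-xr$ annihilates $b$. \textbf{Proposition.} Let $\sigma\colon R\to S$ be a flat epimorphism of commutative rings, that is, an epimorphism in the category of commutative rings such that $S$ is a flat $R$-module, and let $B$ be a quasi-module over $R$. Here $S\otimes_R B$ is formed with the left action of $R$ on $B$ and $B\otimes_R S$ with the right action of $R$ on $B$. Then: (a) the $R$-$R$-bimodule maps $$S\otimes_R B\longrightarrow S\otimes_R B\otimes_R S\longleftarrow B\otimes_R S,\qquad s\otimes b\longmapsto s\otimes b\otimes 1,\qquad 1\otimes b\otimes t\longleftarrow b\otimes t,$$ induced by $\sigma$ are isomorphisms; hence $S\otimes_R B\simeq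 B\otimes_R S$ is an $S$-$S$-bimodule, the right action of $S$ on $S\otimes_R B$ being transported from $S\otimes_R B\otimes_R S$; (b) the $S$-$S$-bimodule $S\otimes_R B$ is a quasi-module over $S$. -/

import Mathlib

open MulOpposite
open scoped TensorProduct RightActions

universe u v

/-! Conventions.  A bimodule with commutative rings `L` acting on the left and `R` acting on the
right is an abelian group `M` with `[Module L M]`, `[Module Rᵐᵒᵖ M]` and
`[SMulCommClass L Rᵐᵒᵖ M]`.  We write `l • m` for the left action and `m <• r = op r • m` for the
right action. -/

section QuasiModule

variable {R : Type*} [CommRing R] {B : Type*} [AddCommGroup B] [Module R B] [Module Rᵐᵒᵖ B]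

/-- The commutator operator `θ_r(b) = r b - b r` on an `R`-`R`-bimodule. -/
def bimodTheta (r : R) (b : B) : B := r • b - b <• r

/-- The filtration `F_n^{(r)} B`, `n ≥ 0`: with `F_{-1}^{(r)} B = 0`, one puts
`F_n^{(r)} B = {b | r b - b r ∈ F_{n-1}^{(r)} B}`. -/
def quasiFiltration (r : R) : ℕ → Set B
  | 0 => {b | bimodTheta r b ∈ ({0} : Set B)}
  | n + 1 => {b | bimodTheta r b ∈ quasiFiltration r n}

theorem mem_quasiFiltration_iff (r : R) (n : ℕ) (b : B) :
    b ∈ quasiFiltration r n ↔ (bimodTheta r)^[n + 1] b = 0 := by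
  induction n generalizing b with
  | zero => rfl
  | succ n ih => exact ih (bimodTheta r b)

variable (R B) in
/-- An `R`-`R`-bimodule `B` is a quasi-module over `R` if `B` is the union of the `F_n^{(r)} B`,
`n ≥ 0`, for every `r` in `R`. -/
def IsQuasiModule [SMulCommClass R Rᵐᵒᵖ B] : Prop :=
  ∀ r : R, (⋃ n : ℕ, quasiFiltration r n) = (Set.univ : Set B)

theorem isQuasiModule_iff [SMulCommClass R Rᵐᵒᵖ B] :
    IsQuasiModule R B ↔ ∀ (r : R) (b : B), ∃ n : ℕ, (bimodTheta r)^[n + 1] b = 0 := by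
  simp only [IsQuasiModule, Set.eq_univ_iff_forall, Set.mem_iUnion, mem_quasiFiltration_iff]

end QuasiModule

section Bimodule

/-- A homomorphism of `L`-`R`-bimodules. -/
structure BimoduleHom (L R M N : Type*) [Semiring L] [Semiring R] [AddCommGroup M]
    [AddCommGroup N] [Module L M] [Module Rᵐᵒᵖ M] [Module L N] [Module Rᵐᵒᵖ N] where
  toFun : M → N
  map_add : ∀ x y : M, toFun (x + y) = toFun x + toFun y
  map_smul : ∀ (l : L) (x : M), toFun (l • x) = l • toFun x
  map_op_smul : ∀ (r : R) (x : M), toFun (x <• r) = toFun x <• r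

/-- A right module `A` over a commutative ring `R`, regarded as a left `R`-module. -/
def RightAsLeft (_R A : Type*) : Type _ := A

instance (R A : Type*) [AddCommGroup A] : AddCommGroup (RightAsLeft R A) :=
  inferInstanceAs (AddCommGroup A)

/-- The scalar `r` acts on `a` as `a <• r`. -/
instance (R A : Type*) [CommRing R] [AddCommGroup A] [Module Rᵐᵒᵖ A] :
    Module R (RightAsLeft R A) :=
  Module.compHom A (RingEquiv.toOpposite R).toRingHom

/-- The left action on an `L`-`R`-bimodule, as a ring homomorphism to the ring of endomorphisms of
the underlying right `R`-module. -/
def RightAsLeft.leftEnd (L R A : Type*) [CommRing L] [CommRing R] [AddCommGroup A] [Module L A]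
    [Module Rᵐᵒᵖ A] [SMulCommClass L Rᵐᵒᵖ A] : L →+* Module.End R (RightAsLeft R A) where
  toFun l :=
    { toFun := fun a => (l • (show A from a) : A)
      map_add' := fun a b => smul_add l (show A from a) (show A from b)
      map_smul' := fun r a => smul_comm l (op r) (show A from a) }
  map_one' := LinearMap.ext fun a => one_smul L (show A from a)
  map_mul' := fun l l' => LinearMap.ext fun a => mul_smul l l' (show A from a)
  map_zero' := LinearMap.ext fun a => zero_smul L (show A from a)
  map_add' := fun l l' => LinearMap.ext fun a => add_smul l l' (show A from a)

/-- The action of a ring on `M ⊗[R] N` through `R`-linear endomorphisms of `M`. -/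
abbrev tensorLeftAct {L R M N : Type*} [Semiring L] [CommRing R] [AddCommGroup M] [Module R M]
    [AddCommGroup N] [Module R N] (f : L →+* Module.End R M) : Module L (M ⊗[R] N) :=
  Module.compHom (M ⊗[R] N) ((Module.End.rTensorAlgHom R M N).toRingHom.comp f)

/-- The action of a ring on `M ⊗[R] N` through `R`-linear endomorphisms of `N`. -/
abbrev tensorRightAct {T R M N : Type*} [Semiring T] [CommRing R] [AddCommGroup M] [Module R M]
    [AddCommGroup N] [Module R N] (f : T →+* Module.End R N) : Module T (M ⊗[R] N) :=
  Module.compHom (M ⊗[R] N) ((Module.End.lTensorAlgHom R N M).toRingHom.comp f)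

end Bimodule

section Extension

set_option linter.unusedSectionVars false

variable (R S B : Type*) [CommRing R] [CommRing S] [Algebra R S] [AddCommGroup B]
  [Module R B] [Module Rᵐᵒᵖ B] [SMulCommClass R Rᵐᵒᵖ B]

/-- The right multiplication action of `S` on itself, by `R`-linear maps. -/
def rightMulEnd : Sᵐᵒᵖ →+* Module.End R S := Module.toModuleEnd R S

/-! ### The `S`-`R`-bimodule `S ⊗_R B`

The tensor product uses the left action of `R` on `B`. The right action of `R` comes from the right
action on `B`, and the left action of `R` is the restriction of the left action of `S`. -/

/-- `S ⊗_R B` -/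
def LeftExt (R S B : Type*) [CommRing R] [CommRing S] [Algebra R S] [AddCommGroup B]
    [Module R B] : Type _ := S ⊗[R] B

instance : AddCommGroup (LeftExt R S B) := inferInstanceAs (AddCommGroup (S ⊗[R] B))

instance : Module S (LeftExt R S B) := inferInstanceAs (Module S (S ⊗[R] B))

instance : Module R (LeftExt R S B) := Module.compHom (LeftExt R S B) (algebraMap R S)

instance : Module Rᵐᵒᵖ (LeftExt R S B) :=
  haveI : SMulCommClass Rᵐᵒᵖ R B := SMulCommClass.symm R Rᵐᵒᵖ B
  tensorRightAct (M := S) (Module.toModuleEnd R B : Rᵐᵒᵖ →+* Module.End R B)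

section
variable {R S B}

/-- The element `s ⊗ b` of `S ⊗_R B`. -/
def LeftExt.mk (s : S) (b : B) : LeftExt R S B := s ⊗ₜ[R] b

theorem LeftExt.induction {p : LeftExt R S B → Prop} (h0 : p 0)
    (hmk : ∀ (s : S) (b : B), p (LeftExt.mk s b)) (hadd : ∀ x y, p x → p y → p (x + y))
    (x : LeftExt R S B) : p x :=
  TensorProduct.induction_on x h0 hmk hadd

theorem LeftExt.balanced (s : S) (r : R) (b : B) :
    LeftExt.mk (R := R) (s * algebraMap R S r) b = LeftExt.mk s (r • b) := by
  rw [mul_comm, ← Algebra.smul_def]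
  exact TensorProduct.smul_tmul r s b

theorem LeftExt.smul_mk (t s : S) (b : B) :
    t • LeftExt.mk (R := R) s b = LeftExt.mk (t * s) b := rfl

theorem LeftExt.algebraMap_smul (r : R) (x : LeftExt R S B) : r • x = algebraMap R S r • x := rfl

theorem LeftExt.op_smul_mk (s : S) (b : B) (r : R) :
    LeftExt.mk (R := R) s b <• r = LeftExt.mk s (b <• r) := rfl

end

instance : SMulCommClass S Rᵐᵒᵖ (LeftExt R S B) where
  smul_comm s r x := by
    induction x using LeftExt.induction with
    | h0 => simp only [smul_zero]
    | hmk t b => rfl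
    | hadd x y hx hy => simp only [smul_add, hx, hy]

instance : SMulCommClass R Rᵐᵒᵖ (LeftExt R S B) where
  smul_comm r r' x := smul_comm (algebraMap R S r) r' x

/-! ### The `R`-`S`-bimodule `B ⊗_R S`

The tensor product uses the right action of `R` on `B`. The left action of `R` comes from the left
action on `B`, and the right action of `R` is the restriction of the right action of `S`. -/

/-- `B ⊗_R S` -/
def RightExt (R S B : Type*) [CommRing R] [CommRing S] [Algebra R S] [AddCommGroup B]
    [Module Rᵐᵒᵖ B] : Type _ := RightAsLeft R B ⊗[R] S

instance : AddCommGroup (RightExt R S B) := inferInstanceAs (AddCommGroup (RightAsLeft R B ⊗[R] S))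

instance : Module R (RightExt R S B) :=
  tensorLeftAct (N := S) (RightAsLeft.leftEnd R R B)

instance : Module Sᵐᵒᵖ (RightExt R S B) :=
  tensorRightAct (M := RightAsLeft R B) (rightMulEnd R S)

instance : Module Rᵐᵒᵖ (RightExt R S B) := Module.compHom (RightExt R S B) (algebraMap R S).op

section
variable {R S B}

/-- The element `b ⊗ s` of `B ⊗_R S`. -/
def RightExt.mk (b : B) (s : S) : RightExt R S B := (show RightAsLeft R B from b) ⊗ₜ[R] s

theorem RightExt.induction {p : RightExt R S B → Prop} (h0 : p 0)
    (hmk : ∀ (b : B) (s : S), p (RightExt.mk b s)) (hadd : ∀ x y, p x → p y → p (x + y))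
    (x : RightExt R S B) : p x :=
  TensorProduct.induction_on x h0 hmk hadd

theorem RightExt.balanced (b : B) (r : R) (s : S) :
    RightExt.mk (R := R) (b <• r) s = RightExt.mk b (algebraMap R S r * s) := by
  rw [← Algebra.smul_def]
  exact TensorProduct.smul_tmul r (show RightAsLeft R B from b) s

theorem RightExt.smul_mk (r : R) (b : B) (s : S) :
    r • RightExt.mk (R := R) b s = RightExt.mk (r • b) s := rfl

theorem RightExt.op_smul_mk (b : B) (s t : S) :
    RightExt.mk (R := R) b s <• t = RightExt.mk b (s * t) := rfl

theorem RightExt.op_algebraMap_smul (x : RightExt R S B) (r : R) :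
    x <• r = x <• algebraMap R S r := rfl

end

instance : SMulCommClass R Sᵐᵒᵖ (RightExt R S B) where
  smul_comm r s x := by
    induction x using RightExt.induction with
    | h0 => simp only [smul_zero]
    | hmk b t => rfl
    | hadd x y hx hy => simp only [smul_add, hx, hy]

instance : SMulCommClass R Rᵐᵒᵖ (RightExt R S B) where
  smul_comm r r' x := smul_comm r ((algebraMap R S).op r') x

/-! ### The `S`-`S`-bimodule `S ⊗_R B ⊗_R S`

Here `S ⊗_R B ⊗_R S = (S ⊗_R B) ⊗_R S`, where the second tensor product uses the right action of
`R` on `S ⊗_R B`. The left and right actions of `R` are the restrictions of those of `S`. -/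

/-- `S ⊗_R B ⊗_R S` -/
def BothExt (R S B : Type*) [CommRing R] [CommRing S] [Algebra R S] [AddCommGroup B]
    [Module R B] [Module Rᵐᵒᵖ B] [SMulCommClass R Rᵐᵒᵖ B] : Type _ :=
  RightAsLeft R (LeftExt R S B) ⊗[R] S

instance : AddCommGroup (BothExt R S B) :=
  inferInstanceAs (AddCommGroup (RightAsLeft R (LeftExt R S B) ⊗[R] S))

instance : Module S (BothExt R S B) :=
  tensorLeftAct (N := S) (RightAsLeft.leftEnd S R (LeftExt R S B))

instance : Module Sᵐᵒᵖ (BothExt R S B) :=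
  tensorRightAct (M := RightAsLeft R (LeftExt R S B)) (rightMulEnd R S)

instance : Module R (BothExt R S B) := Module.compHom (BothExt R S B) (algebraMap R S)

instance : Module Rᵐᵒᵖ (BothExt R S B) := Module.compHom (BothExt R S B) (algebraMap R S).op

section
variable {R S B}

/-- The element `x ⊗ t` of `(S ⊗_R B) ⊗_R S`. -/
def BothExt.mk (x : LeftExt R S B) (t : S) : BothExt R S B :=
  (show RightAsLeft R (LeftExt R S B) from x) ⊗ₜ[R] t

theorem BothExt.induction {p : BothExt R S B → Prop} (h0 : p 0)
    (hmk : ∀ (x : LeftExt R S B) (t : S), p (BothExt.mk x t))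
    (hadd : ∀ x y, p x → p y → p (x + y)) (x : BothExt R S B) : p x :=
  TensorProduct.induction_on x h0 hmk hadd

theorem BothExt.balanced (x : LeftExt R S B) (r : R) (t : S) :
    BothExt.mk (x <• r) t = BothExt.mk x (algebraMap R S r * t) := by
  rw [← Algebra.smul_def]
  exact TensorProduct.smul_tmul r (show RightAsLeft R (LeftExt R S B) from x) t

theorem BothExt.add_mk (x y : LeftExt R S B) (t : S) :
    BothExt.mk (x + y) t = BothExt.mk x t + BothExt.mk y t :=
  TensorProduct.add_tmul (show RightAsLeft R (LeftExt R S B) from x) y t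

theorem BothExt.smul_mk (s : S) (x : LeftExt R S B) (t : S) :
    s • BothExt.mk x t = BothExt.mk (s • x) t := rfl

theorem BothExt.op_smul_mk (x : LeftExt R S B) (t s : S) :
    BothExt.mk x t <• s = BothExt.mk x (t * s) := rfl

theorem BothExt.algebraMap_smul (r : R) (x : BothExt R S B) : r • x = algebraMap R S r • x := rfl

theorem BothExt.op_algebraMap_smul (x : BothExt R S B) (r : R) :
    x <• r = x <• algebraMap R S r := rfl

end

instance : SMulCommClass S Sᵐᵒᵖ (BothExt R S B) where
  smul_comm s t x := by
    induction x using BothExt.induction with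
    | h0 => simp only [smul_zero]
    | hmk b t => rfl
    | hadd x y hx hy => simp only [smul_add, hx, hy]

instance : SMulCommClass R Rᵐᵒᵖ (BothExt R S B) where
  smul_comm r r' x := smul_comm (algebraMap R S r) ((algebraMap R S).op r') x

/-! ### The natural maps -/

/-- The `R`-`R`-bimodule map `S ⊗_R B → S ⊗_R B ⊗_R S`, `x ↦ x ⊗ 1`. -/
def leftExtMap : BimoduleHom R R (LeftExt R S B) (BothExt R S B) where
  toFun x := BothExt.mk x 1
  map_add x y := BothExt.add_mk x y 1
  map_smul _ _ := rfl
  map_op_smul r x := by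
    rw [BothExt.balanced, BothExt.op_algebraMap_smul, BothExt.op_smul_mk, mul_comm]

theorem leftExtMap_smul (s : S) (x : LeftExt R S B) :
    (leftExtMap R S B).toFun (s • x) = s • (leftExtMap R S B).toFun x := rfl

/-- The map `B → S ⊗_R B`, `b ↦ 1 ⊗ b`, as a map of right `R`-modules. -/
def rightAsLeftUnit : RightAsLeft R B →ₗ[R] RightAsLeft R (LeftExt R S B) where
  toFun b := LeftExt.mk (R := R) (1 : S) (show B from b)
  map_add' a b := TensorProduct.tmul_add (R := R) (1 : S) (show B from a) (show B from b)
  map_smul' _ _ := rfl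

/-- The additive map `B ⊗_R S → S ⊗_R B ⊗_R S` with `b ⊗ t ↦ 1 ⊗ b ⊗ t`. -/
def rightExtAddHom : RightExt R S B →+ BothExt R S B :=
  ((rightAsLeftUnit R S B).rTensor S).toAddMonoidHom

theorem rightExtAddHom_mk (b : B) (t : S) :
    rightExtAddHom R S B (RightExt.mk b t) = BothExt.mk (LeftExt.mk 1 b) t := rfl

/-- The `R`-`R`-bimodule map `B ⊗_R S → S ⊗_R B ⊗_R S` with `b ⊗ t ↦ 1 ⊗ b ⊗ t`. -/
def rightExtMap : BimoduleHom R R (RightExt R S B) (BothExt R S B) where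
  toFun x := rightExtAddHom R S B x
  map_add x y := _root_.map_add (rightExtAddHom R S B) x y
  map_smul r x := by
    induction x using RightExt.induction with
    | h0 => rw [smul_zero, map_zero, smul_zero]
    | hmk b t =>
      rw [RightExt.smul_mk, rightExtAddHom_mk, rightExtAddHom_mk, ← LeftExt.balanced, mul_comm]
      rfl
    | hadd x y hx hy => rw [smul_add, _root_.map_add, _root_.map_add, smul_add, hx, hy]
  map_op_smul r x := by
    induction x using RightExt.induction with
    | h0 => rw [smul_zero, map_zero, smul_zero]
    | hmk b t => rfl
    | hadd x y hx hy => rw [smul_add, _root_.map_add, _root_.map_add, smul_add, hx, hy]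

theorem leftExtMap_mk (s : S) (b : B) :
    (leftExtMap R S B).toFun (LeftExt.mk s b) = BothExt.mk (LeftExt.mk s b) 1 := rfl

theorem rightExtMap_mk (b : B) (t : S) :
    (rightExtMap R S B).toFun (RightExt.mk b t) = BothExt.mk (LeftExt.mk 1 b) t := rfl

theorem rightExtMap_op_smul (x : RightExt R S B) (s : S) :
    (rightExtMap R S B).toFun (x <• s) = (rightExtMap R S B).toFun x <• s := by
  induction x using RightExt.induction with
  | h0 =>
    have h : (rightExtMap R S B).toFun 0 = 0 :=
      map_zero (rightExtAddHom R S B)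
    rw [smul_zero, h, smul_zero]
  | hmk b t => rfl
  | hadd x y hx hy =>
    rw [smul_add, (rightExtMap R S B).map_add, (rightExtMap R S B).map_add, smul_add, hx, hy]

/-! ### `S ⊗_R B` as an `S`-`S`-bimodule -/

/-- If `S ⊗_R B → S ⊗_R B ⊗_R S` is an isomorphism, then `S ⊗_R B` is an `S`-`S`-bimodule, with the
right action of `S` transported from `S ⊗_R B ⊗_R S`. -/
def LeftExtBimod {R S B : Type*} [CommRing R] [CommRing S] [Algebra R S] [AddCommGroup B]
    [Module R B] [Module Rᵐᵒᵖ B] [SMulCommClass R Rᵐᵒᵖ B]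
    (_h : Function.Bijective (leftExtMap R S B).toFun) : Type _ := LeftExt R S B

namespace LeftExtBimod

variable {R S B} (h : Function.Bijective (leftExtMap R S B).toFun)

instance : AddCommGroup (LeftExtBimod h) := inferInstanceAs (AddCommGroup (LeftExt R S B))

instance : Module S (LeftExtBimod h) := inferInstanceAs (Module S (LeftExt R S B))

/-- The isomorphism `S ⊗_R B → S ⊗_R B ⊗_R S`. -/
noncomputable def toBoth : LeftExtBimod h ≃+ BothExt R S B :=
  AddEquiv.ofBijective (AddMonoidHom.mk' (leftExtMap R S B).toFun (leftExtMap R S B).map_add) h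

/-- The right action of `S` on `S ⊗_R B`, for which `S ⊗_R B → S ⊗_R B ⊗_R S` is right
`S`-linear. -/
noncomputable instance : SMul Sᵐᵒᵖ (LeftExtBimod h) where
  smul s x := (toBoth h).symm (s • toBoth h x)

theorem toBoth_op_smul (s : Sᵐᵒᵖ) (x : LeftExtBimod h) :
    toBoth h (s • x) = s • toBoth h x :=
  (toBoth h).apply_symm_apply _

theorem toBoth_smul (s : S) (x : LeftExtBimod h) : toBoth h (s • x) = s • toBoth h x :=
  leftExtMap_smul R S B s x

noncomputable instance : Module Sᵐᵒᵖ (LeftExtBimod h) :=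
  Function.Injective.module Sᵐᵒᵖ (toBoth h).toAddMonoidHom (toBoth h).injective
    (toBoth_op_smul h)

instance : SMulCommClass S Sᵐᵒᵖ (LeftExtBimod h) where
  smul_comm s t x := (toBoth h).injective <| by
    rw [toBoth_smul, toBoth_op_smul, toBoth_op_smul, toBoth_smul, smul_comm]

/-- The right action of `S` extends the right action of `R` on `S ⊗_R B`. -/
theorem op_algebraMap_smul (x : LeftExt R S B) (r : R) :
    ((show LeftExtBimod h from x) <• algebraMap R S r : LeftExtBimod h) = x <• r :=
  (toBoth h).injective <|
    (toBoth_op_smul h _ _).trans ((leftExtMap R S B).map_op_smul r x).symm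

end LeftExtBimod

end Extension

/-!
The proof is elementwise and rests on two facts about a flat epimorphism `R → S`.

* If `N` is an `R`-module and `x : N` becomes zero in `S ⊗ N`, then the annihilator of `x` extends
  to the unit ideal of `S`: this is flatness applied to `R → N`, `r ↦ r x`
  (`map_torsionOf_eq_top`).  Applied to the class of `s` in `S / R`, which dies in
  `S ⊗ (S / R)` because `s ⊗ 1 = 1 ⊗ s` in `S ⊗ S`, it shows that every `s : S` is multiplied into
  the image of `R` by an ideal of `R` which extends to the unit ideal (`map_conductorIdeal_eq_top`).
* If `W` is an `S`-submodule of `P` and `x : P` is such that every `r` in an ideal extending to the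
  unit ideal has a power with `r ^ n x ∈ W`, then `x ∈ W`, since the radical of
  the ideal `{s | s x ∈ W}` is the unit ideal (`mem_of_forall_pow_smul_mem`).

In a quasi-module the two actions `a`, `b` of `r` commute and `a - b` is locally nilpotent, so for
every `x` some `a ^ n x` lies in the image of `b`, and vanishes when `b x = 0`.  Thus an ideal which
governs `x` through one action governs it, up to powers, through the other one.  For
`S ⊗ B → S ⊗ B ⊗ S` the ideal comes from the right action of `R` and is moved to the left, where
`S` already acts; for `B ⊗ S → S ⊗ B ⊗ S` it comes from the left action and is moved to the
right.  Taking `W = 0` gives injectivity and `W` the image gives surjectivity.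

For the last claim, let `J` be the annihilator in `S ⊗_ℤ S` of an element of the `S`-`S`-bimodule
`S ⊗_R B`.  For `r` in `R` the element `r ⊗ 1 - 1 ⊗ r` is in the radical of `J`, so the two maps from
`S` to `(S ⊗_ℤ S) / rad J` agree on `R`; as `R → S` is an epimorphism they are equal, that is,
`s ⊗ 1 - 1 ⊗ s ∈ rad J` for all `s : S`.
-/

/-! ### Flat epimorphisms -/

section FlatEpi

variable {R S : Type*} [CommRing R] [CommRing S] [Algebra R S]

/-- Over a flat algebra `S`, the annihilator of an element which vanishes in `S ⊗ N` extends to the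
unit ideal. -/
theorem map_torsionOf_eq_top [Module.Flat R S] {N : Type*} [AddCommGroup N] [Module R N] (x : N)
    (hx : (1 : S) ⊗ₜ[R] x = 0) : (Ideal.torsionOf R N x).map (algebraMap R S) = ⊤ := by
  have hex := Module.Flat.lTensor_exact S
    (LinearMap.exact_subtype_ker_map (LinearMap.toSpanSingleton R N x))
  obtain ⟨z, hz⟩ := (hex ((1 : S) ⊗ₜ[R] (1 : R))).1 (by simpa using hx)
  -- The image of `S ⊗ I` in `S ⊗ R = S` is the extension of `I`.
  have key : ∀ z : S ⊗[R] LinearMap.ker (LinearMap.toSpanSingleton R N x),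
      TensorProduct.rid R S
        ((LinearMap.ker (LinearMap.toSpanSingleton R N x)).subtype.lTensor S z) ∈
        (Ideal.torsionOf R N x).map (algebraMap R S) := by
    intro z
    induction z using TensorProduct.induction_on with
    | zero => simp
    | tmul s r =>
      simp only [LinearMap.lTensor_tmul, Submodule.subtype_apply, TensorProduct.rid_tmul,
        Algebra.smul_def]
      exact Ideal.mul_mem_right _ _ (Ideal.mem_map_of_mem _ r.2)
    | add x y hx hy => simpa only [map_add] using add_mem hx hy
  rw [Ideal.eq_top_iff_one]
  simpa [hz] using key z

variable (R) in
/-- The conductor of `s : S` into `R`: the ideal of all `r : R` such that `r s` lies in the image of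
`R`. -/
def conductorIdeal (s : S) : Ideal R :=
  (LinearMap.range (Algebra.linearMap R S)).comap (LinearMap.toSpanSingleton R S s)

theorem mem_conductorIdeal {s : S} {r : R} :
    r ∈ conductorIdeal R s ↔ ∃ r' : R, algebraMap R S r' = algebraMap R S r * s := by
  simp [conductorIdeal, Algebra.smul_def]

theorem map_conductorIdeal_eq_top [Algebra.IsEpi R S] [Module.Flat R S] (s : S) :
    (conductorIdeal R s).map (algebraMap R S) = ⊤ := by
  let Q := LinearMap.range (Algebra.linearMap R S)
  have hone : Q.mkQ 1 = 0 := by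
    rw [Submodule.mkQ_apply, Submodule.Quotient.mk_eq_zero]
    exact ⟨1, map_one (algebraMap R S)⟩
  have hs : (1 : S) ⊗ₜ[R] Q.mkQ s = 0 := by
    have h := congrArg (Q.mkQ.lTensor S)
      (Algebra.isEpi_iff_forall_one_tmul_eq R S |>.1 inferInstance s)
    simpa only [LinearMap.lTensor_tmul, hone, TensorProduct.tmul_zero] using h
  have h := map_torsionOf_eq_top _ hs
  convert h using 2
  ext r
  rw [Ideal.mem_torsionOf_iff, ← map_smul, Submodule.mkQ_apply, Submodule.Quotient.mk_eq_zero]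
  rfl

/-- Ring homomorphisms out of an epimorphic `R`-algebra are determined by their restriction to `R`,
for targets in any universe. -/
theorem ringHom_eq_of_isEpi [Algebra.IsEpi R S] {T : Type*} [CommRing T] (f g : S →+* T)
    (h : ∀ r : R, f (algebraMap R S r) = g (algebraMap R S r)) : f = g := by
  let : Algebra R T := (g.comp (algebraMap R S)).toAlgebra
  let f' : S →ₐ[R] T := ⟨f, h⟩
  let g' : S →ₐ[R] T := ⟨g, fun _ => rfl⟩
  ext s
  have hs := congrArg (Algebra.TensorProduct.lift f' g' fun _ _ => .all _ _)
    (Algebra.isEpi_iff_forall_one_tmul_eq R S |>.1 inferInstance s)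
  simpa using! hs.symm

theorem mem_of_forall_pow_smul_mem {P : Type*} [AddCommGroup P] [Module S P] (W : Submodule S P)
    (x : P) {I : Ideal R} (hI : I.map (algebraMap R S) = ⊤)
    (h : ∀ r ∈ I, ∃ n : ℕ, algebraMap R S r ^ n • x ∈ W) : x ∈ W := by
  let J : Ideal S := W.comap (LinearMap.toSpanSingleton S P x)
  have hle : I.map (algebraMap R S) ≤ J.radical := Ideal.map_le_iff_le_comap.2 h
  rw [hI, top_le_iff, Ideal.radical_eq_top, Ideal.eq_top_iff_one] at hle
  simpa [J] using hle

end FlatEpi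

/-! ### Exchanging the two actions on a quasi-module -/

/-- If `a` and `b` commute and a power of `a - b` kills `x`, then `a ^ n x` is a polynomial in `a` and
`b` applied to `b x`, because `b = a - (a - b)` divides `a ^ n - (a - b) ^ n`. -/
theorem Commute.exists_pow_apply_eq {M : Type*} [AddCommGroup M] {a b : Module.End ℤ M}
    (h : Commute a b) {n : ℕ} {x : M} (hx : ((a - b) ^ n) x = 0) :
    ∃ y, (a ^ n) x = b y ∧ (b x = 0 → (a ^ n) x = 0) := by
  have hc : Commute a (a - b) := (Commute.refl a).sub_right h
  have h1 := hc.mul_geom_sum₂ n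
  have h2 := hc.geom_sum₂_mul n
  rw [sub_sub_cancel] at h1 h2
  have key : (a ^ n) x = (a ^ n - (a - b) ^ n) x := by
    rw [LinearMap.sub_apply, hx, sub_zero]
  refine ⟨_, key.trans (DFunLike.congr_fun h1 x).symm, fun hb => ?_⟩
  rw [key, ← h2, Module.End.mul_apply, hb, map_zero]

section QuasiModule

variable {R : Type*} [CommRing R] {B : Type*} [AddCommGroup B] [Module R B] [Module Rᵐᵒᵖ B]

theorem bimodTheta_iterate (r : R) (n : ℕ) (b : B) :
    (bimodTheta r)^[n] b =
      ((Module.toModuleEnd ℤ (S := R) B r - Module.toModuleEnd ℤ (S := Rᵐᵒᵖ) B (op r)) ^ n) b := by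
  rw [Module.End.coe_pow]
  rfl

variable [SMulCommClass R Rᵐᵒᵖ B]

theorem commute_toModuleEnd (r s : R) :
    Commute (Module.toModuleEnd ℤ (S := R) B r) (Module.toModuleEnd ℤ (S := Rᵐᵒᵖ) B (op s)) :=
  LinearMap.ext fun b => smul_comm r (op s) b

theorem IsQuasiModule.exists_pow_smul_eq (hB : IsQuasiModule R B) (r : R) (b : B) :
    ∃ (n : ℕ) (c : B), r ^ n • b = c <• r ∧ (b <• r = 0 → r ^ n • b = 0) := by
  obtain ⟨n, hn⟩ := isQuasiModule_iff.1 hB r b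
  rw [bimodTheta_iterate] at hn
  obtain ⟨c, hc⟩ := (commute_toModuleEnd r r).exists_pow_apply_eq hn
  rw [← map_pow] at hc
  exact ⟨n + 1, c, hc⟩

theorem IsQuasiModule.exists_op_pow_smul_eq (hB : IsQuasiModule R B) (r : R) (b : B) :
    ∃ (n : ℕ) (c : B), b <• r ^ n = r • c ∧ (r • b = 0 → b <• r ^ n = 0) := by
  obtain ⟨n, hn⟩ := isQuasiModule_iff.1 hB r b
  rw [bimodTheta_iterate, ← neg_sub, neg_pow, Module.End.mul_apply] at hn
  have hn' : ((Module.toModuleEnd ℤ (S := Rᵐᵒᵖ) B (op r) -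
      Module.toModuleEnd ℤ (S := R) B r) ^ (n + 1)) b = 0 := by
    rcases neg_one_pow_eq_or (Module.End ℤ B) (n + 1) with h | h
    · simpa [h] using hn
    · rw [h] at hn
      exact neg_eq_zero.1 hn
  obtain ⟨c, hc⟩ := (commute_toModuleEnd r r).symm.exists_pow_apply_eq hn'
  rw [← map_pow, ← op_pow] at hc
  exact ⟨n + 1, c, hc⟩

end QuasiModule

/-! ### Extension of scalars on the left -/

section Extension

variable {R S B : Type*} [CommRing R] [CommRing S] [Algebra R S] [AddCommGroup B]
  [Module R B] [Module Rᵐᵒᵖ B] [SMulCommClass R Rᵐᵒᵖ B]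

theorem LeftExt.bimodTheta_mk (r : R) (s : S) (b : B) :
    bimodTheta r (LeftExt.mk (R := R) s b) = LeftExt.mk s (bimodTheta r b) := by
  unfold bimodTheta
  rw [LeftExt.algebraMap_smul, LeftExt.smul_mk, mul_comm, LeftExt.balanced, LeftExt.op_smul_mk]
  exact (TensorProduct.tmul_sub s (r • b) (b <• r)).symm

/-- Here `S ⊗ B` is a quasi-module over `R`, the left action of `R` being restricted from `S`. -/
theorem IsQuasiModule.leftExt (hB : IsQuasiModule R B) : IsQuasiModule R (LeftExt R S B) := by
  rw [isQuasiModule_iff] at hB ⊢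
  intro r x
  induction x using LeftExt.induction with
  | h0 => exact ⟨0, by rw [bimodTheta_iterate, map_zero]⟩
  | hmk s b =>
    obtain ⟨n, hn⟩ := hB r b
    refine ⟨n, ?_⟩
    have h : Function.Semiconj (LeftExt.mk (R := R) s) (bimodTheta (B := B) r) (bimodTheta r) :=
      fun b => (LeftExt.bimodTheta_mk r s b).symm
    rw [← (h.iterate_right (n + 1)).eq b, hn]
    exact TensorProduct.tmul_zero _ _
  | hadd x y hx hy =>
    obtain ⟨n, hn⟩ := hx
    obtain ⟨m, hm⟩ := hy
    refine ⟨n + m, ?_⟩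
    rw [bimodTheta_iterate] at hn hm ⊢
    rw [map_add, show n + m + 1 = m + (n + 1) by ring, pow_add, Module.End.mul_apply, hn,
      map_zero, zero_add, ← pow_add, show m + (n + 1) = n + (m + 1) by ring, pow_add,
      Module.End.mul_apply, hm, map_zero]

/-! ### The two comparison maps -/

theorem leftExtMap_injective [Module.Flat R S] (hB : IsQuasiModule R B) :
    Function.Injective (leftExtMap R S B).toFun := by
  let f := AddMonoidHom.mk' (leftExtMap R S B).toFun (leftExtMap R S B).map_add
  refine (injective_iff_map_eq_zero f).2 fun x hx => ?_
  have hx' : (1 : S) ⊗ₜ[R] (show RightAsLeft R (LeftExt R S B) from x) = 0 := by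
    have h := congrArg (TensorProduct.comm R (RightAsLeft R (LeftExt R S B)) S) hx
    exact h.trans (map_zero _)
  refine (Submodule.mem_bot S).1 <| mem_of_forall_pow_smul_mem ⊥ x (map_torsionOf_eq_top _ hx')
    fun r hr => ?_
  obtain ⟨n, -, -, h⟩ := (hB.leftExt (S := S)).exists_pow_smul_eq r x
  refine ⟨n, (Submodule.mem_bot S).2 ?_⟩
  rw [← map_pow, ← LeftExt.algebraMap_smul]
  exact h hr

theorem leftExtMap_surjective [Algebra.IsEpi R S] [Module.Flat R S] (hB : IsQuasiModule R B) :
    Function.Surjective (leftExtMap R S B).toFun := by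
  let W : Submodule S (BothExt R S B) := LinearMap.range
    { toFun := (leftExtMap R S B).toFun
      map_add' := (leftExtMap R S B).map_add
      map_smul' := leftExtMap_smul R S B : LeftExt R S B →ₗ[S] BothExt R S B }
  suffices h : ∀ z, z ∈ W from h
  intro z
  induction z using BothExt.induction with
  | h0 => exact zero_mem W
  | hmk x t =>
    -- The conductor of `t` acts from the right; its powers are to be used from the left.
    refine mem_of_forall_pow_smul_mem W _ (map_conductorIdeal_eq_top (R := R) t) fun r hr => ?_
    obtain ⟨r', hr'⟩ := mem_conductorIdeal.1 hr
    obtain ⟨n, y, hy, -⟩ := (hB.leftExt (S := S)).exists_pow_smul_eq r x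
    refine ⟨n, y <• r', ?_⟩
    change BothExt.mk (y <• r') 1 = _
    rw [BothExt.smul_mk, ← map_pow, ← LeftExt.algebraMap_smul, hy, BothExt.balanced,
      BothExt.balanced, mul_one, hr']
  | hadd x y hx hy => exact add_mem hx hy

theorem RightExt.mk_eq_zero_of_leftExt_mk_eq_zero [Module.Flat R S] (hB : IsQuasiModule R B)
    {b : B} (hb : LeftExt.mk (R := R) (1 : S) b = 0) (t : S) :
    RightExt.mk (R := R) b t = 0 := by
  -- The right action of `S` is used, so `B ⊗ S` is turned into a left `S`-module.
  let x : RightAsLeft S (RightExt R S B) := RightExt.mk b t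
  suffices h : x ∈ (⊥ : Submodule S (RightAsLeft S (RightExt R S B))) from h
  refine mem_of_forall_pow_smul_mem ⊥ x (map_torsionOf_eq_top b hb) fun r hr => ?_
  obtain ⟨n, -, -, h⟩ := hB.exists_op_pow_smul_eq r b
  refine ⟨n, (Submodule.mem_bot S).2 ?_⟩
  change RightExt.mk (R := R) b t <• algebraMap R S r ^ n = 0
  rw [RightExt.op_smul_mk, mul_comm, ← map_pow, ← RightExt.balanced, h hr]
  exact TensorProduct.zero_tmul _ _

theorem rightExtMap_injective [Module.Flat R S] (hB : IsQuasiModule R B) :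
    Function.Injective (rightExtMap R S B).toFun := by
  refine (injective_iff_map_eq_zero (rightExtAddHom R S B)).2 fun x hx => ?_
  have hex := Module.Flat.rTensor_exact S
    (LinearMap.exact_subtype_ker_map (rightAsLeftUnit R S B))
  obtain ⟨z, rfl⟩ := (hex x).1 hx
  induction z using TensorProduct.induction_on with
  | zero => exact map_zero _
  | tmul b t => exact RightExt.mk_eq_zero_of_leftExt_mk_eq_zero hB b.2 t
  | add y z hy hz =>
    have h : ∀ w, rightExtAddHom R S B
        ((LinearMap.ker (rightAsLeftUnit R S B)).subtype.rTensor S w) = 0 :=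
      fun w => (hex _).2 ⟨w, rfl⟩
    exact (map_add _ _ _).trans ((congrArg₂ (· + ·) (hy (h y)) (hz (h z))).trans (add_zero _))

theorem rightExtMap_surjective [Algebra.IsEpi R S] [Module.Flat R S] (hB : IsQuasiModule R B) :
    Function.Surjective (rightExtMap R S B).toFun := by
  let W : Submodule S (RightAsLeft S (BothExt R S B)) := LinearMap.range
    { toFun := (rightExtMap R S B).toFun
      map_add' := (rightExtMap R S B).map_add
      map_smul' := fun s x => rightExtMap_op_smul R S B x s :
        RightAsLeft S (RightExt R S B) →ₗ[S] RightAsLeft S (BothExt R S B) }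
  suffices h : ∀ z : BothExt R S B, z ∈ W from h
  have hmk : ∀ (s : S) (b : B) (t : S), BothExt.mk (LeftExt.mk (R := R) s b) t ∈ W := by
    intro s b t
    -- The conductor of `s` acts from the left; its powers are to be used from the right.
    refine mem_of_forall_pow_smul_mem W _ (map_conductorIdeal_eq_top (R := R) s) fun r hr => ?_
    obtain ⟨r', hr'⟩ := mem_conductorIdeal.1 hr
    obtain ⟨n, c, hc, -⟩ := hB.exists_op_pow_smul_eq r b
    refine ⟨n, RightExt.mk (r' • c) t, ?_⟩
    change BothExt.mk (LeftExt.mk (R := R) 1 (r' • c)) t =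
      BothExt.mk (LeftExt.mk (R := R) s b) t <• algebraMap R S r ^ n
    rw [BothExt.op_smul_mk, mul_comm, ← map_pow, ← BothExt.balanced, LeftExt.op_smul_mk, hc,
      ← LeftExt.balanced, ← LeftExt.balanced, one_mul, hr', mul_comm]
  intro z
  induction z using BothExt.induction with
  | h0 => exact zero_mem W
  | hmk x t =>
    induction x using LeftExt.induction with
    | h0 =>
      rw [show BothExt.mk (0 : LeftExt R S B) t = 0 from TensorProduct.zero_tmul _ _]
      exact zero_mem W
    | hmk s b => exact hmk s b t
    | hadd x y hx hy =>
      rw [BothExt.add_mk]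
      exact add_mem hx hy
  | hadd x y hx hy => exact add_mem hx hy

end Extension

/-! ### Quasi-modules over an epimorphic extension -/

/-- On an `S`-`S`-bimodule the operators `θ_s` are locally nilpotent as soon as those with `s` in
the image of an epimorphism `R → S` are. -/
theorem isQuasiModule_of_isEpi {R S M : Type*} [CommRing R] [CommRing S] [Algebra R S]
    [Algebra.IsEpi R S] [AddCommGroup M] [Module S M] [Module Sᵐᵒᵖ M] [SMulCommClass S Sᵐᵒᵖ M]
    (h : ∀ (r : R) (x : M), ∃ n : ℕ, (bimodTheta (algebraMap R S r))^[n] x = 0) :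
    IsQuasiModule S M := by
  rw [isQuasiModule_iff]
  intro s x
  -- The action of `S ⊗ S` on `M`, in which `a ⊗ b` sends `m` to `a m b`.
  let φ : S ⊗[ℤ] S →ₐ[ℤ] Module.End ℤ M := Algebra.TensorProduct.lift (S := ℤ)
    (Module.toModuleEnd ℤ (S := S) M).toIntAlgHom
    ((Module.toModuleEnd ℤ (S := Sᵐᵒᵖ) M).comp (RingEquiv.toOpposite S).toRingHom).toIntAlgHom
    fun a b => commute_toModuleEnd a b
  -- The annihilator of `x`.
  let J : Ideal (S ⊗[ℤ] S) :=
    { carrier := {a | φ a x = 0}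
      add_mem' := fun {a b} (ha : φ a x = 0) (hb : φ b x = 0) => by
        change φ (a + b) x = 0
        rw [map_add, LinearMap.add_apply, ha, hb, add_zero]
      zero_mem' := by
        change φ 0 x = 0
        rw [map_zero]
        rfl
      smul_mem' := fun a b (hb : φ b x = 0) => by
        change φ (a * b) x = 0
        rw [map_mul, Module.End.mul_apply, hb, map_zero] }
  have hφ : ∀ (a : S) (n : ℕ),
      φ ((a ⊗ₜ 1 - 1 ⊗ₜ a) ^ n) x = (bimodTheta a)^[n] x := by
    intro a n
    have hl : φ (a ⊗ₜ 1) = Module.toModuleEnd ℤ (S := S) M a :=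
      LinearMap.ext fun y => congrArg (a • ·) (one_smul Sᵐᵒᵖ y)
    have hr : φ (1 ⊗ₜ a) = Module.toModuleEnd ℤ (S := Sᵐᵒᵖ) M (op a) :=
      LinearMap.ext fun y => one_smul S (y <• a)
    rw [bimodTheta_iterate, map_pow, map_sub, hl, hr]
  have heq := ringHom_eq_of_isEpi (R := R) (S := S) (T := (S ⊗[ℤ] S) ⧸ J.radical)
    ((Ideal.Quotient.mk J.radical).comp Algebra.TensorProduct.includeLeftRingHom)
    ((Ideal.Quotient.mk J.radical).comp
      (Algebra.TensorProduct.includeRight (R := ℤ) (A := S) (B := S)).toRingHom)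
    fun r => by
      obtain ⟨n, hn⟩ := h r x
      exact Ideal.Quotient.eq.2 ⟨n, (hφ _ n).trans hn⟩
  obtain ⟨n, hn⟩ := Ideal.Quotient.eq.1 (RingHom.congr_fun heq s)
  refine ⟨n, (hφ s (n + 1)).symm.trans ?_⟩
  have hn' : (s ⊗ₜ[ℤ] (1 : S) - 1 ⊗ₜ[ℤ] s) ^ n ∈ J := hn
  rw [pow_succ']
  exact J.mul_mem_left _ hn'

theorem mainTheorem3 {R S : Type u} [CommRing R] [CommRing S] [Algebra R S]
    (hepi : CategoryTheory.Epi (CommRingCat.ofHom (algebraMap R S)))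
    (hflat : Module.Flat R S)
    {B : Type v} [AddCommGroup B] [Module R B] [Module Rᵐᵒᵖ B] [SMulCommClass R Rᵐᵒᵖ B]
    (hB : IsQuasiModule R B) :
    ∃ hleft : Function.Bijective (leftExtMap R S B).toFun,
      Function.Bijective (rightExtMap R S B).toFun ∧
        IsQuasiModule S (LeftExtBimod hleft) := by
  have : Algebra.IsEpi R S := CommRingCat.epi_iff_epi.1 hepi
  have hleft : Function.Bijective (leftExtMap R S B).toFun :=
    ⟨leftExtMap_injective hB, leftExtMap_surjective hB⟩
  refine ⟨hleft, ⟨rightExtMap_injective hB, rightExtMap_surjective hB⟩,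
    isQuasiModule_of_isEpi (R := R) fun r x => ?_⟩
  obtain ⟨n, hn⟩ := isQuasiModule_iff.1 (hB.leftExt (S := S)) r x
  refine ⟨n + 1, Eq.trans ?_ hn⟩
  -- On the image of `R`, the transported right action is the one coming from `B`.
  have hθ : (bimodTheta (algebraMap R S r) : LeftExtBimod hleft → LeftExtBimod hleft) =
      (bimodTheta r : LeftExt R S B → LeftExt R S B) :=
    funext fun y => congrArg (fun z : LeftExt R S B => (r • (show LeftExt R S B from y)) - z)
      (LeftExtBimod.op_algebraMap_smul hleft y r)
  exact congrArg (fun f : LeftExt R S B → LeftExt R S B => f^[n + 1] x) hθ
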